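/- Let $G$ be a finite group. For an irreducible complex character $\chi$ of $G$ put $\ker\chi=\{g\in G:\chi(g)=\chi(1)\}$ and $Z(\chi)=\{g\in G:|\chi(g)|=\chi(1)\}$, and say that $\chi$ has central type if $\chi(g)=0$ for every $g\in G\setminus Z(\chi)$. For a normal subgroup $N$ of $G$ let $\mathrm{Irr}(G\mid N)$ be the set of irreducible complex characters $\chi$ of $G$ with $N\not\subseteq\ker\chi$. For $g\in G$ let $\mathrm{cl}_G(g)$ be its conjugacy class and let $[g,G]$ be the subgroup generated by all commutators $[g,x]=g^{-1}x^{-1}gx$ with $x\in G$; the element $g$ is called flat in $G$ if $\mathrm{cl}_G(g)=g[g,G]$. Theorem. Let $N$ be a nontrivial normal subgroup of $G$ such that every $\chi\in\mathrm{Irr}(G\mid N)$ has central type. Then $G$ is nilpotent, and $\mathrm{cl}_G(g)=g[g,G]$ for every $g\in N$; that is, every element of $N$ is flat in $G$. -/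

import Mathlib

open scoped Pointwise

namespace FinChar

/-- `Irr(G)`: the set of irreducible complex characters of `G`, i.e. the functions
`g ↦ tr (ρ g)` for `ρ` an irreducible representation of `G` on some `ℂⁿ`. -/
def irr (G : Type*) [Group G] : Set (G → ℂ) :=
  {χ | ∃ (n : ℕ) (ρ : Representation ℂ G (Fin n → ℂ)),
    ρ.IsIrreducible ∧ χ = ρ.character}

variable {G : Type*} [Group G]

/-- `ker χ = {g ∈ G : χ(g) = χ(1)}`. -/
def ker (χ : G → ℂ) : Set G :=
  {g | χ g = χ 1}

/-- The center of a character, `Z(χ) = {g ∈ G : |χ(g)| = χ(1)}`. -/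
def center (χ : G → ℂ) : Set G :=
  {g | ((‖χ g‖ : ℝ) : ℂ) = χ 1}

/-- `Irr(G | N)`: the irreducible characters of `G` whose kernels do not contain `N`. -/
def irrOver (N : Subgroup G) : Set (G → ℂ) :=
  {χ | χ ∈ irr G ∧ ¬ (N : Set G) ⊆ ker χ}

/-- `χ` has central type: it vanishes on `G \ Z(χ)`. -/
def HasCentralType (χ : G → ℂ) : Prop :=
  ∀ g : G, g ∉ center χ → χ g = 0

/-- `[g, G]`: the subgroup generated by the commutators `[g, x] = g⁻¹ x⁻¹ g x`, `x ∈ G`. -/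
def commWith (g : G) : Subgroup G :=
  Subgroup.closure (Set.range fun x : G => g⁻¹ * x⁻¹ * g * x)

/-- `g` is flat in `G`: its conjugacy class `cl_G(g)` is the coset `g[g, G]`. -/
def IsFlat (g : G) : Prop :=
  conjugatesOf g = g • (commWith g : Set G)

end FinChar

namespace FinChar

/-! Fix `g`, put K = [g, G], and write Ĉ for the sum of all x⁻¹gx, K̂ and N̂ for the sums over K and
N. In each irreducible representation of central type |K|Ĉ and |G|gK̂ agree: g is scalar, or both
vanish. The factor |N| - N̂ kills the representations trivial on N, so |K|Ĉ(|N| - N̂) = |G|gK̂(|N| -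
N̂) in ℂ[G]. Coefficients at gk, k ∈ K, give `count_identity`. If N ⊄ K its right side is positive,
so gk is conjugate to g. If N ≤ K it is zero, and g is conjugate to all of gN. For g ∈ N we have K ≤
N, so g is flat in both cases.

For nilpotency, flatness gives a central z ∈ N of prime order p, and the hypothesis passes to ⟨z⟩.
If p ∤ o(g), then g and gz are not conjugate, so ⟨z⟩ ⊄ [g, G]; thus [g, G] consists of flat elements
and lies in the hypercenter, as then does g. The quotient by the hypercenter is a p-group with
trivial center, hence trivial. -/

/-! ### Traces of maximal modulus. -/

theorem re_conj_mul_multiset_sum_le {c : ℂ} (hc : ‖c‖ = 1) (s : Multiset ℂ)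
    (hs : ∀ z ∈ s, ‖z‖ = 1) : (starRingEnd ℂ c * s.sum).re ≤ s.card := by
  refine (Complex.re_le_norm _).trans ?_
  rw [norm_mul, RCLike.norm_conj, hc, one_mul]
  induction s using Multiset.induction_on with
  | empty => simp
  | cons a s ih =>
    rw [Multiset.sum_cons, Multiset.card_cons]
    push_cast
    have h1 := norm_add_le a s.sum
    have h2 := ih fun z hz => hs z (Multiset.mem_cons_of_mem hz)
    have h3 := hs a (Multiset.mem_cons_self a s)
    linarith

theorem eq_of_norm_one_of_re_conj_mul {c z : ℂ} (hc : ‖c‖ = 1) (hz : ‖z‖ = 1)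
    (h : 1 ≤ (starRingEnd ℂ c * z).re) : z = c := by
  have hc' : c.re * c.re + c.im * c.im = 1 := by
    rw [← Complex.normSq_apply, Complex.normSq_eq_norm_sq, hc, one_pow]
  have hz' : z.re * z.re + z.im * z.im = 1 := by
    rw [← Complex.normSq_apply, Complex.normSq_eq_norm_sq, hz, one_pow]
  simp only [Complex.mul_re, Complex.conj_re, Complex.conj_im] at h
  have h0 : (z.re - c.re) ^ 2 + (z.im - c.im) ^ 2 ≤ 0 := by nlinarith
  have h1 := sq_nonneg (z.re - c.re)
  have h2 := sq_nonneg (z.im - c.im)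
  apply Complex.ext
  · nlinarith [pow_eq_zero_iff (two_ne_zero) |>.1 (le_antisymm (by linarith) h1)]
  · nlinarith [pow_eq_zero_iff (two_ne_zero) |>.1 (le_antisymm (by linarith) h2)]

/-- Unit complex numbers whose sum has the largest possible modulus are all equal. -/
theorem exists_forall_eq_of_norm_multiset_sum (s : Multiset ℂ) (hs : ∀ z ∈ s, ‖z‖ = 1)
    (h : ‖s.sum‖ = s.card) : ∃ c : ℂ, ∀ z ∈ s, z = c := by
  rcases Multiset.empty_or_exists_mem s with rfl | ⟨w, hw⟩
  · exact ⟨0, by simp⟩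
  have hpos : (0 : ℝ) < s.card := by
    exact_mod_cast Multiset.card_pos_iff_exists_mem.2 ⟨w, hw⟩
  have hcne : (s.card : ℂ) ≠ 0 := by exact_mod_cast hpos.ne'
  set c : ℂ := s.sum / s.card with hcdef
  have hc : ‖c‖ = 1 := by rw [hcdef, norm_div, h, Complex.norm_natCast, div_self hpos.ne']
  refine ⟨c, fun z hz => eq_of_norm_one_of_re_conj_mul hc (hs z hz) ?_⟩
  obtain ⟨t, rfl⟩ := Multiset.exists_cons_of_mem hz
  have hsum : (z ::ₘ t).sum = ((z ::ₘ t).card : ℂ) * c := by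
    rw [hcdef, mul_div_cancel₀ _ hcne]
  have h1 := re_conj_mul_multiset_sum_le hc t fun y hy => hs y (Multiset.mem_cons_of_mem hy)
  have h2 : (starRingEnd ℂ c * (z ::ₘ t).sum).re = (z ::ₘ t).card := by
    rw [hsum, mul_left_comm, ← Complex.normSq_eq_conj_mul_self, Complex.normSq_eq_norm_sq, hc]
    simp
  rw [Multiset.sum_cons, mul_add, Complex.add_re, Multiset.card_cons] at h2
  push_cast at h2
  linarith

/-- An operator of finite order whose trace has maximal modulus is scalar. -/
theorem exists_eq_algebraMap_of_norm_trace {V : Type*} [AddCommGroup V] [Module ℂ V]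
    [Module.Finite ℂ V] (T : Module.End ℂ V) {m : ℕ} (hm : m ≠ 0) (hT : T ^ m = 1)
    (htr : ‖LinearMap.trace ℂ V T‖ = Module.finrank ℂ V) :
    ∃ c : ℂ, T = algebraMap ℂ (Module.End ℂ V) c := by
  have hsp : T.charpoly.Splits := IsAlgClosed.splits _
  have hss : T.IsSemisimple := by
    refine Module.End.isSemisimple_of_squarefree_aeval_eq_zero
      (p := Polynomial.X ^ m - 1) (Polynomial.Separable.squarefree ?_) (by simp [hT])
    exact Polynomial.X_pow_sub_one_separable_iff.2 (by exact_mod_cast hm)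
  have hprod := hsp.eq_prod_roots_of_monic T.charpoly_monic
  have hcard : T.charpoly.roots.card = Module.finrank ℂ V := by
    rw [← hsp.natDegree_eq_card_roots, T.charpoly_natDegree]
  have hroot : ∀ z ∈ T.charpoly.roots, ‖z‖ = 1 := by
    intro z hz
    have hev : T.HasEigenvalue z := by
      rw [Module.End.hasEigenvalue_iff_isRoot_charpoly]
      exact Polynomial.isRoot_of_mem_roots hz
    obtain ⟨v, hv⟩ := hev.exists_hasEigenvector
    have h1 := hv.pow_apply m
    rw [hT, Module.End.one_apply] at h1
    have h2 : (z ^ m - 1) • v = 0 := by rw [sub_smul, one_smul, ← h1, sub_self]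
    have h3 := (smul_eq_zero.1 h2).resolve_right hv.2
    exact Complex.norm_eq_one_of_pow_eq_one (sub_eq_zero.1 h3) hm
  rw [Module.End.trace_eq_sum_roots_charpoly_of_splits hsp, ← hcard] at htr
  obtain ⟨c, hc⟩ := exists_forall_eq_of_norm_multiset_sum _ hroot htr
  -- By Cayley–Hamilton T - c is nilpotent; it is also semisimple, hence zero.
  refine ⟨c, sub_eq_zero.1 (Module.End.eq_zero_of_isNilpotent_isSemisimple ?_
    (Module.End.isSemisimple_sub_algebraMap_iff.2 hss))⟩
  refine ⟨T.charpoly.roots.card, ?_⟩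
  have h1 := T.aeval_self_charpoly
  rw [hprod, Multiset.eq_replicate_card.2 hc, Multiset.map_replicate,
    Multiset.prod_replicate] at h1
  simpa using h1

/-! ### Schur's lemma and the group algebra. -/

/-- Schur's lemma over `ℂ`. -/
theorem exists_eq_algebraMap_of_commute {G V : Type*} [Group G] [AddCommGroup V] [Module ℂ V]
    [Module.Finite ℂ V] (ρ : Representation ℂ G V) [ρ.IsIrreducible] (T : Module.End ℂ V)
    (hT : ∀ g, T * ρ g = ρ g * T) : ∃ c : ℂ, T = algebraMap ℂ (Module.End ℂ V) c := by
  obtain ⟨c, hc⟩ :=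
    (Representation.IsIrreducible.algebraMap_intertwiningMap_bijective_of_isAlgClosed
      (ρ := ρ)).2 ⟨T, hT⟩
  refine ⟨c, ?_⟩
  ext v
  have := congrArg (fun f : ρ.IntertwiningMap ρ => f.toLinearMap v) hc
  exact this.symm

theorem nontrivial_of_isIrreducible {G V : Type*} [Group G] [AddCommGroup V] [Module ℂ V]
    (ρ : Representation ℂ G V) [ρ.IsIrreducible] : Nontrivial V :=
  have : IsSimpleModule (MonoidAlgebra ℂ G) ρ.asModule := inferInstance
  IsSimpleModule.nontrivial (MonoidAlgebra ℂ G) ρ.asModule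

/-- The irreducible representations of a finite group separate the elements of its group
algebra. -/
theorem eq_zero_of_forall_asAlgebraHom_eq_zero {G : Type*} [Group G] [Finite G]
    (a : MonoidAlgebra ℂ G)
    (ha : ∀ (n : ℕ) (ρ : Representation ℂ G (Fin n → ℂ)), ρ.IsIrreducible →
      ρ.asAlgebraHom a = 0) : a = 0 := by
  let A := MonoidAlgebra ℂ G
  have : Fintype G := Fintype.ofFinite G
  have : NeZero (Nat.card G : ℂ) := ⟨by exact_mod_cast Nat.card_pos.ne'⟩
  have hfin : Module.Finite ℂ A := inferInstance
  -- Each simple left ideal is transported to coordinates, where `ha` applies; by Maschke these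
  -- ideals span, so a · 1 = 0.
  have hsimple : ∀ S : Submodule A A, IsSimpleModule A S → ∀ s ∈ S, a * s = 0 := by
    intro S hS s hs
    have : Module.Finite ℂ S := inferInstanceAs (Module.Finite ℂ (S.restrictScalars ℂ))
    let e : S ≃ₗ[ℂ] (Fin (Module.finrank ℂ S) → ℂ) := (Module.finBasis ℂ S).equivFun
    let φ : A →ₐ[ℂ] Module.End ℂ (Fin (Module.finrank ℂ S) → ℂ) :=
      (e.conjAlgEquiv ℂ).toAlgHom.comp (Algebra.lsmul ℂ ℂ S)
    have hφ : ∀ (b : A) (x : S), φ b (e x) = e (b • x) := by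
      intro b x
      simp [φ, LinearEquiv.conjAlgEquiv_apply]
    let ρ : Representation ℂ G (Fin (Module.finrank ℂ S) → ℂ) :=
      (φ : A →* _).comp (MonoidAlgebra.of ℂ G)
    have hρ : ρ.asAlgebraHom = φ := by
      refine MonoidAlgebra.algHom_ext (fun g => ?_) (by ext)
      rw [Representation.asAlgebraHom_single_one]
      rfl
    have hirr : ρ.IsIrreducible := by
      rw [Representation.irreducible_iff_isSimpleModule_asModule]
      let f : S ≃ₗ[A] ρ.asModule :=
        { e.toAddEquiv.trans ρ.asModuleEquiv.symm.toAddEquiv with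
          map_smul' := fun b x => by
            apply ρ.asModuleEquiv.injective
            rw [RingHom.id_apply, Representation.asModuleEquiv_map_smul, hρ]
            exact (hφ b x).symm }
      exact IsSimpleModule.congr f.symm
    have h0 := hφ a ⟨s, hs⟩
    rw [← hρ, ha _ ρ hirr, LinearMap.zero_apply] at h0
    have h1 := (LinearEquiv.map_eq_zero_iff e).1 h0.symm
    exact congrArg Subtype.val h1
  have htop := IsSemisimpleModule.sSup_simples_eq_top A A
  have hall : ∀ s : A, a * s = 0 := by
    intro s
    have hs : s ∈ sSup {m : Submodule A A | IsSimpleModule A m} := htop ▸ Submodule.mem_top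
    rw [sSup_eq_iSup'] at hs
    induction hs using Submodule.iSup_induction' with
    | mem i x hx => exact hsimple i.1 i.2 x hx
    | zero => exact mul_zero a
    | add x y _ _ hx hy => rw [mul_add, hx, hy, add_zero]
  simpa using hall 1

variable {G : Type*} [Group G]

/-! ### Irreducible characters: center, kernel, normal subgroups. -/

section Representation

variable {n : ℕ} (ρ : Representation ℂ G (Fin n → ℂ))

theorem cast_ne_zero_of_isIrreducible [ρ.IsIrreducible] : (n : ℂ) ≠ 0 := by
  have := nontrivial_of_isIrreducible ρ
  rintro h
  obtain rfl : n = 0 := by exact_mod_cast h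
  exact not_nontrivial (Fin 0 → ℂ) this

theorem character_eq_of_eq_algebraMap {g : G} {c : ℂ}
    (hc : ρ g = algebraMap ℂ (Module.End ℂ (Fin n → ℂ)) c) : ρ.character g = c * n := by
  rw [Representation.character, hc, Algebra.algebraMap_eq_smul_one, map_smul, LinearMap.trace_one]
  simp

theorem character_one_eq : ρ.character 1 = n := by
  simp [Representation.char_one]

theorem exists_eq_algebraMap_of_mem_center [Finite G] {g : G} (hg : g ∈ center ρ.character) :
    ∃ c : ℂ, ρ g = algebraMap ℂ (Module.End ℂ (Fin n → ℂ)) c := by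
  have h1 : ((‖ρ.character g‖ : ℝ) : ℂ) = ρ.character 1 := hg
  rw [character_one_eq] at h1
  refine exists_eq_algebraMap_of_norm_trace (ρ g) (m := orderOf g) (orderOf_pos g).ne' ?_ ?_
  · rw [← map_pow, pow_orderOf_eq_one, map_one]
  · rw [Module.finrank_fin_fun]
    exact_mod_cast h1

theorem eq_one_of_mem_ker [Finite G] [ρ.IsIrreducible] {g : G} (hg : g ∈ ker ρ.character) : ρ g = 1 := by
  have h1 : ρ.character g = ρ.character 1 := hg
  rw [character_one_eq] at h1
  obtain ⟨c, hc⟩ := exists_eq_algebraMap_of_mem_center ρ (g := g) (by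
    change ((‖ρ.character g‖ : ℝ) : ℂ) = ρ.character 1
    rw [h1, character_one_eq, Complex.norm_natCast]
    simp)
  rw [character_eq_of_eq_algebraMap ρ hc] at h1
  have h2 : c = 1 := mul_right_cancel₀ (cast_ne_zero_of_isIrreducible ρ) (by rw [h1, one_mul])
  rw [hc, h2, map_one]

/-- A normal subgroup acts trivially on an irreducible representation or its sum acts as zero. -/
theorem forall_eq_one_or_sum_eq_zero [ρ.IsIrreducible] (N : Subgroup G) [hN : N.Normal]
    [Fintype N] : (∀ x ∈ N, ρ x = 1) ∨ ∑ x : N, ρ x = 0 := by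
  obtain ⟨c, hc⟩ := exists_eq_algebraMap_of_commute ρ (∑ x : N, ρ x) (fun g => by
    rw [Finset.sum_mul, Finset.mul_sum]
    refine Fintype.sum_equiv (MulAut.conjNormal (H := N) g⁻¹).toEquiv _ _ fun x => ?_
    rw [← map_mul, ← map_mul]
    congr 1
    simp [mul_assoc])
  by_cases h : c = 0
  · right
    rw [hc, h, map_zero]
  · left
    intro y hy
    have h1 : ρ y * ∑ x : N, ρ x = ∑ x : N, ρ x := by
      rw [Finset.mul_sum]
      refine Fintype.sum_equiv (Equiv.mulLeft (⟨y, hy⟩ : N)) _ _ fun x => ?_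
      rw [← map_mul]
      rfl
    rw [hc, Algebra.algebraMap_eq_smul_one, mul_smul_comm, mul_one] at h1
    exact smul_right_injective _ h h1

end Representation

/-! ### The subgroup [g, G]. -/

theorem commutator_mem_commWith (g x : G) : g⁻¹ * x⁻¹ * g * x ∈ commWith g :=
  Subgroup.subset_closure ⟨x, rfl⟩

instance commWith_normal (g : G) : (commWith g).Normal := by
  refine ⟨fun k hk y => ?_⟩
  have hle : commWith g ≤ (commWith g).comap (MulAut.conj y).toMonoidHom := by
    refine (Subgroup.closure_le _).2 ?_
    rintro _ ⟨x, rfl⟩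
    -- y[g, x]y⁻¹ = [g, y⁻¹]⁻¹[g, xy⁻¹].
    have h1 := mul_mem (inv_mem (commutator_mem_commWith g y⁻¹))
      (commutator_mem_commWith g (x * y⁻¹))
    rw [SetLike.mem_coe, Subgroup.mem_comap]
    convert h1 using 1
    simp only [MulEquiv.toMonoidHom_eq_coe, MonoidHom.coe_coe, MulAut.conj_apply]
    group
  exact hle hk

theorem commWith_le_of_normal {M : Subgroup G} [hM : M.Normal] {g : G} (hg : g ∈ M) :
    commWith g ≤ M := by
  refine (Subgroup.closure_le _).2 ?_
  rintro _ ⟨x, rfl⟩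
  have := hM.conj_mem g hg x⁻¹
  have h1 := mul_mem (inv_mem hg) this
  simpa [mul_assoc] using h1

theorem conj_mem_leftCoset_commWith (g x : G) : ∃ k ∈ commWith g, x⁻¹ * g * x = g * k :=
  ⟨_, commutator_mem_commWith g x, by group⟩

theorem conjugatesOf_subset_leftCoset_commWith (g : G) :
    conjugatesOf g ⊆ g • (commWith g : Set G) := by
  intro h hh
  obtain ⟨x, rfl⟩ := isConj_iff.1 (show IsConj g h from hh)
  obtain ⟨k, hk, h1⟩ := conj_mem_leftCoset_commWith g x⁻¹
  rw [inv_inv] at h1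
  exact ⟨k, hk, h1.symm⟩

theorem coeff_sum_single {ι M : Type*} [Fintype ι] (f : ι → M) (h : M) :
    (∑ i, MonoidAlgebra.single (f i) (1 : ℂ)).coeff h = (Nat.card {i // f i = h} : ℂ) := by
  classical
  rw [MonoidAlgebra.coeff_sum, Finsupp.finsetSum_apply]
  simp only [MonoidAlgebra.coeff_single, Finsupp.single_apply]
  rw [Finset.sum_boole, Nat.card_eq_fintype_card, Fintype.card_subtype]

/-! ### Class sums against coset sums. -/

section CountIdentity

variable [Finite G]

/-- In an irreducible representation of central type, the class sum of `g` and the sum over the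
coset `g[g, G]` agree up to normalization. -/
theorem card_smul_sum_conj_eq [Fintype G] (g : G) [Fintype (commWith g)] {n : ℕ}
    (ρ : Representation ℂ G (Fin n → ℂ)) [ρ.IsIrreducible] (hρ : HasCentralType ρ.character) :
    (Fintype.card (commWith g) : ℂ) • ∑ x : G, ρ (x⁻¹ * g * x) =
      (Fintype.card G : ℂ) • (ρ g * ∑ k : commWith g, ρ k) := by
  by_cases hg : g ∈ center ρ.character
  · obtain ⟨c, hc⟩ := exists_eq_algebraMap_of_mem_center ρ hg
    have hconj : ∀ x, ρ (x⁻¹ * g * x) = ρ g := fun x => by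
      rw [map_mul, map_mul, hc, mul_assoc, Algebra.commutes, ← mul_assoc, ← map_mul,
        inv_mul_cancel, map_one, one_mul]
    have hle : commWith g ≤ ρ.ker := by
      refine (Subgroup.closure_le _).2 ?_
      rintro _ ⟨x, rfl⟩
      change ρ (g⁻¹ * x⁻¹ * g * x) = 1
      rw [mul_assoc, mul_assoc, ← mul_assoc x⁻¹, map_mul, hconj, ← map_mul, inv_mul_cancel, map_one]
    have hk : ∀ k : commWith g, ρ k = 1 := fun k => hle k.2
    simp only [hconj, hk, Finset.sum_const, Finset.card_univ, ← Nat.cast_smul_eq_nsmul ℂ,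
      mul_smul_comm, mul_one]
    rw [smul_comm]
  · have h0 : ρ.character g = 0 := hρ g hg
    have hn := cast_ne_zero_of_isIrreducible ρ
    have hC : ∑ x : G, ρ (x⁻¹ * g * x) = 0 := by
      obtain ⟨c, hc⟩ := exists_eq_algebraMap_of_commute ρ (∑ x : G, ρ (x⁻¹ * g * x)) (fun y => by
        rw [Finset.sum_mul, Finset.mul_sum]
        refine Fintype.sum_equiv (Equiv.mulRight y) _ _ fun x => ?_
        rw [← map_mul, ← map_mul]
        congr 1
        simp [mul_assoc])
      have h1 := congrArg (LinearMap.trace ℂ (Fin n → ℂ)) hc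
      have h2 : ∀ x : G, LinearMap.trace ℂ (Fin n → ℂ) (ρ (x⁻¹ * g * x)) = 0 := fun x => by
        have := ρ.char_conj g x⁻¹
        rw [inv_inv] at this
        exact this.trans h0
      rw [map_sum, Finset.sum_eq_zero fun x _ => h2 x, Algebra.algebraMap_eq_smul_one, map_smul,
        LinearMap.trace_one, Module.finrank_fin_fun, smul_eq_mul] at h1
      rw [hc, (mul_eq_zero.1 h1.symm).resolve_right hn, map_zero]
    -- If [g, G] acted trivially, `ρ g` would be a scalar of trace zero, contradicting its
    -- invertibility.
    have hK : ∑ k : commWith g, ρ k = 0 := by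
      refine (forall_eq_one_or_sum_eq_zero ρ (commWith g)).resolve_left fun hk => ?_
      obtain ⟨c, hc⟩ := exists_eq_algebraMap_of_commute ρ (ρ g) (fun y => by
        rw [← map_mul, ← map_mul]
        have h1 : g * y = y * g * (g⁻¹ * y⁻¹ * g * y) := by group
        rw [h1, map_mul ρ (y * g), hk _ (commutator_mem_commWith g y), mul_one])
      have h1 := character_eq_of_eq_algebraMap ρ hc
      rw [h0] at h1
      have h2 : ρ g = 0 := by rw [hc, (mul_eq_zero.1 h1.symm).resolve_right hn, map_zero]
      have h3 : ρ 1 = 0 := by rw [← mul_inv_cancel g, map_mul, h2, zero_mul]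
      have h4 := character_one_eq ρ
      rw [Representation.character, h3, map_zero] at h4
      exact hn h4.symm
    rw [hC, hK, mul_zero, smul_zero, smul_zero]

/-- Comparison of coefficients at `g * k₀` of the class sum of `g` and of the sum over `g[g, G]`,
modulo the part of the group algebra fixed by `N`. -/
theorem count_identity (N : Subgroup G) [N.Normal]
    (hct : ∀ χ ∈ irrOver N, HasCentralType χ) (g k₀ : G) (hk₀ : k₀ ∈ commWith g) :
    (Nat.card (commWith g) : ℤ) * (Nat.card N * Nat.card {x : G // x⁻¹ * g * x = g * k₀} -
        Nat.card {q : G × N // q.1⁻¹ * g * q.1 * q.2 = g * k₀}) =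
      Nat.card G * (Nat.card N - Nat.card {m : N // (m : G) ∈ commWith g}) := by
  classical
  have := Fintype.ofFinite G
  have := Fintype.ofFinite N
  have := Fintype.ofFinite (commWith g)
  let δ : G → MonoidAlgebra ℂ G := fun x => MonoidAlgebra.single x 1
  have hδ : ∀ x y, δ x * δ y = δ (x * y) := fun x y => by simp [δ]
  have key : (Fintype.card (commWith g) : ℂ) • ((∑ x : G, δ (x⁻¹ * g * x)) *
        ((Fintype.card N : ℂ) • 1 - ∑ m : N, δ m)) -
      (Fintype.card G : ℂ) • ((δ g * ∑ k : commWith g, δ k) *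
        ((Fintype.card N : ℂ) • 1 - ∑ m : N, δ m)) = 0 := by
    refine eq_zero_of_forall_asAlgebraHom_eq_zero _ fun n ρ hρ => ?_
    have hδρ : ∀ x, ρ.asAlgebraHom (δ x) = ρ x := fun x => ρ.asAlgebraHom_single_one x
    simp only [map_sub, map_smul, map_mul ρ.asAlgebraHom, map_sum, map_one, hδρ]
    rcases forall_eq_one_or_sum_eq_zero ρ N with h | h
    · have h1 : ∀ m : N, ρ m = 1 := fun m => h m m.2
      simp [h1, Finset.sum_const, ← Nat.cast_smul_eq_nsmul ℂ]
    · by_cases hχ : (N : Set G) ⊆ ker ρ.character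
      · have h1 : ∀ m : N, ρ m = 1 := fun m => eq_one_of_mem_ker ρ (hχ m.2)
        simp [h1, Finset.sum_const, ← Nat.cast_smul_eq_nsmul ℂ]
      · have h2 := card_smul_sum_conj_eq g ρ (hct _ ⟨⟨n, ρ, hρ, rfl⟩, hχ⟩)
        rw [← smul_mul_assoc, ← smul_mul_assoc, h2, sub_self]
  have hcoeff := congrArg (fun a : MonoidAlgebra ℂ G => a.coeff (g * k₀)) key
  have e1 : (∑ x : G, δ (x⁻¹ * g * x)).coeff (g * k₀) =
      (Nat.card {x : G // x⁻¹ * g * x = g * k₀} : ℂ) := coeff_sum_single _ _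
  have e2 : ((∑ x : G, δ (x⁻¹ * g * x)) * ∑ m : N, δ m).coeff (g * k₀) =
      (Nat.card {q : G × N // q.1⁻¹ * g * q.1 * q.2 = g * k₀} : ℂ) := by
    rw [Fintype.sum_mul_sum, ← Fintype.sum_prod_type']
    simp only [hδ]
    exact coeff_sum_single _ _
  have e3 : (δ g * ∑ k : commWith g, δ k).coeff (g * k₀) = 1 := by
    rw [Finset.mul_sum]
    simp only [hδ]
    rw [coeff_sum_single, Nat.cast_eq_one, Nat.card_eq_one_iff_unique]
    exact ⟨⟨fun a b => Subtype.ext (Subtype.ext (mul_left_cancel (a.2.trans b.2.symm)))⟩,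
      ⟨⟨⟨k₀, hk₀⟩, rfl⟩⟩⟩
  have e4 : ((δ g * ∑ k : commWith g, δ k) * ∑ m : N, δ m).coeff (g * k₀) =
      (Nat.card {m : N // (m : G) ∈ commWith g} : ℂ) := by
    rw [Finset.mul_sum Finset.univ (fun k : commWith g => δ k), Fintype.sum_mul_sum, ← Fintype.sum_prod_type']
    simp only [hδ]
    rw [coeff_sum_single]
    congr 1
    -- In km = k₀ the element m determines k = k₀m⁻¹, which lies in [g, G] exactly when m does.
    refine Nat.card_congr ⟨fun q => ⟨q.1.2, ?_⟩,
      fun m => ⟨(⟨k₀ * (m.1 : G)⁻¹, mul_mem hk₀ (inv_mem m.2)⟩, m.1), by simp [mul_assoc]⟩, ?_, fun _ => rfl⟩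
    · have h1 := q.2
      rw [mul_assoc] at h1
      rw [← inv_mul_eq_iff_eq_mul.2 (mul_left_cancel h1).symm]
      exact mul_mem (inv_mem q.1.1.2) hk₀
    · rintro ⟨⟨k, m⟩, h⟩
      rw [mul_assoc] at h
      have h1 := mul_left_cancel h
      simp [← h1]
  simp only [mul_sub, mul_smul_comm, mul_one, MonoidAlgebra.coeff_sub, MonoidAlgebra.coeff_smul,
    Finsupp.sub_apply, Finsupp.smul_apply, e1, e2, e3, e4, smul_eq_mul,
    MonoidAlgebra.coeff_zero, Finsupp.zero_apply] at hcoeff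
  simp only [Nat.card_eq_fintype_card (α := N), Nat.card_eq_fintype_card (α := G),
    Nat.card_eq_fintype_card (α := commWith g)]
  have : ∀ a b : ℤ, (a : ℂ) = b → a = b := fun a b h => by exact_mod_cast h
  apply this
  push_cast
  linear_combination hcoeff

end CountIdentity

/-! ### Flatness. -/

section Flat

variable [Finite G]

/-- Under the central type hypothesis, every `g` with `N ⊄ [g, G]` is flat. -/
theorem isFlat_of_not_le_commWith (N : Subgroup G) [N.Normal]
    (hct : ∀ χ ∈ irrOver N, HasCentralType χ) {g : G} (hg : ¬ N ≤ commWith g) : IsFlat g := by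
  refine (conjugatesOf_subset_leftCoset_commWith g).antisymm ?_
  rintro _ ⟨k, hk, rfl⟩
  have h := count_identity N hct g k hk
  have hlt : Nat.card {m : N // (m : G) ∈ commWith g} < Nat.card N := by
    obtain ⟨m, hm, hmk⟩ := SetLike.not_le_iff_exists.1 hg
    exact Finite.card_subtype_lt (x := ⟨m, hm⟩) hmk
  have hK : (0 : ℤ) < Nat.card (commWith g) := by exact_mod_cast Nat.card_pos
  have hG : (0 : ℤ) < Nat.card G := by exact_mod_cast Nat.card_pos
  have hlt' : (0 : ℤ) < Nat.card N - Nat.card {m : N // (m : G) ∈ commWith g} := by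
    rw [sub_pos]
    exact_mod_cast hlt
  have h1 := pos_of_mul_pos_right (h ▸ mul_pos hG hlt') hK.le
  have h2 : Nat.card {x : G // x⁻¹ * g * x = g * k} ≠ 0 := by
    intro h0
    rw [h0] at h1
    push_cast at h1
    linarith [Int.natCast_nonneg (Nat.card {q : G × N // q.1⁻¹ * g * q.1 * q.2 = g * k})]
  obtain ⟨⟨x, hx⟩⟩ := (Nat.card_ne_zero.1 h2).1
  exact isConj_iff.2 ⟨x⁻¹, by simpa using hx⟩

/-- Under the central type hypothesis, if `N ≤ [g, G]` then `g` is conjugate to all of `gN`. -/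
theorem isConj_mul_of_le_commWith (N : Subgroup G) [N.Normal]
    (hct : ∀ χ ∈ irrOver N, HasCentralType χ) {g : G} (hg : N ≤ commWith g) {n : G}
    (hn : n ∈ N) : IsConj g (g * n) := by
  have h := count_identity N hct g n (hg hn)
  have heq : Nat.card {m : N // (m : G) ∈ commWith g} = Nat.card N :=
    Nat.card_congr (Equiv.subtypeUnivEquiv fun m => hg m.2)
  have hK : (Nat.card (commWith g) : ℤ) ≠ 0 := by exact_mod_cast Nat.card_pos.ne'
  rw [heq, sub_self, mul_zero] at h
  have h1 := sub_eq_zero.1 ((mul_eq_zero.1 h).resolve_left hK)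
  have h2 : Nat.card {x : G // x⁻¹ * g * x = g * n} ≠ 0 := by
    intro h0
    rw [h0, Nat.cast_zero, mul_zero] at h1
    have : Nonempty {q : G × N // q.1⁻¹ * g * q.1 * q.2 = g * n} := ⟨⟨(1, ⟨n, hn⟩), by simp⟩⟩
    exact Nat.card_pos.ne (by exact_mod_cast h1)
  obtain ⟨⟨x, hx⟩⟩ := (Nat.card_ne_zero.1 h2).1
  exact isConj_iff.2 ⟨x⁻¹, by simpa using hx⟩

theorem isFlat_of_mem (N : Subgroup G) [N.Normal]
    (hct : ∀ χ ∈ irrOver N, HasCentralType χ) {g : G} (hg : g ∈ N) : IsFlat g := by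
  by_cases h : N ≤ commWith g
  · refine (conjugatesOf_subset_leftCoset_commWith g).antisymm ?_
    rintro _ ⟨k, hk, rfl⟩
    exact isConj_mul_of_le_commWith N hct h (commWith_le_of_normal hg hk)
  · exact isFlat_of_not_le_commWith N hct h

end Flat

/-! ### Flat elements, the hypercenter and nilpotency. -/

theorem IsFlat.eq_one_of_mem_commWith {g : G} (hg : IsFlat g) (h : g ∈ commWith g) : g = 1 := by
  have h1 : (1 : G) ∈ conjugatesOf g := by
    rw [hg]
    exact ⟨g⁻¹, inv_mem h, mul_inv_cancel g⟩
  obtain ⟨x, hx⟩ := isConj_iff.1 (show IsConj g 1 from h1)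
  simpa using hx

/-- A normal subgroup of flat elements lies in every subgroup `Z` that contains each element of it
which is central modulo `Z`. -/
theorem le_of_forall_isFlat [Finite G] (R Z : Subgroup G) [R.Normal] (hR : ∀ g ∈ R, IsFlat g)
    (hZ : ∀ g ∈ R, commWith g ≤ Z → g ∈ Z) : R ≤ Z := by
  have h : ∀ (m : ℕ) (g : G), g ∈ R → Nat.card (commWith g) = m → g ∈ Z := by
    intro m
    induction m using Nat.strong_induction_on with
    | _ m ih =>
      rintro g hg rfl
      refine hZ g hg fun h hh => ?_
      have hhR : h ∈ R := commWith_le_of_normal hg hh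
      have hle : commWith h ≤ commWith g := commWith_le_of_normal hh
      -- Equality would put h in [h, G], so flatness forces h = 1; otherwise [h, G] is strictly
      -- smaller and induction applies.
      by_cases heq : commWith h = commWith g
      · rw [(hR h hhR).eq_one_of_mem_commWith (heq ▸ hh)]
        exact one_mem Z
      · refine ih _ ?_ h hhR rfl
        exact lt_of_not_ge fun hge => heq (Subgroup.eq_of_le_of_card_ge hle hge)
  exact fun g hg => h _ g hg rfl

theorem irrOver_mono {M N : Subgroup G} (h : M ≤ N) : irrOver M ⊆ irrOver N :=
  fun _ hχ => ⟨hχ.1, fun hN => hχ.2 (subset_trans h hN)⟩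

theorem exists_central_prime_order [Finite G] (N : Subgroup G) [N.Normal] (hN : N ≠ ⊥)
    (hflat : ∀ g ∈ N, IsFlat g) : ∃ z ∈ N, z ∈ Subgroup.center G ∧ (orderOf z).Prime := by
  have hex : ∃ g ∈ N, g ∈ Subgroup.center G ∧ g ≠ 1 := by
    by_contra! hcon
    refine hN (le_bot_iff.1 (le_of_forall_isFlat N ⊥ hflat fun g hg h => ?_))
    refine Subgroup.mem_bot.2 (hcon g hg (Subgroup.mem_center_iff.2 fun x => ?_))
    have h1 : g⁻¹ * x⁻¹ * g * x = 1 := Subgroup.mem_bot.1 (h (commutator_mem_commWith g x))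
    have h2 : g * x = x * g * (g⁻¹ * x⁻¹ * g * x) := by group
    rw [h2, h1, mul_one]
  obtain ⟨g, hgN, hgZ, hg1⟩ := hex
  have h1 : orderOf g ≠ 1 := by rwa [Ne, orderOf_eq_one_iff]
  refine ⟨g ^ (orderOf g / (orderOf g).minFac), pow_mem hgN _, pow_mem hgZ _, ?_⟩
  rw [orderOf_pow_orderOf_div (orderOf_pos g).ne' (Nat.minFac_dvd _)]
  exact Nat.minFac_prime h1

/-- The hypercenter of a finite group, with its defining closure property. -/
theorem exists_upperCentralSeries_closed (G : Type*) [Group G] [Finite G] :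
    ∃ n, ∀ g : G, commWith g ≤ Subgroup.upperCentralSeries G n →
      g ∈ Subgroup.upperCentralSeries G n := by
  obtain ⟨n, hn⟩ := WellFoundedGT.monotone_chain_condition
    (⟨Subgroup.upperCentralSeries G, Subgroup.upperCentralSeries_mono G⟩ : ℕ →o Subgroup G)
  refine ⟨n, fun g hg => ?_⟩
  have h1 : Subgroup.upperCentralSeries G n = Subgroup.upperCentralSeries G (n + 1) :=
    hn (n + 1) n.le_succ
  rw [h1, Subgroup.mem_upperCentralSeries_succ_iff]
  intro y
  have h2 := (inferInstance : (Subgroup.upperCentralSeries G n).Normal).conj_mem _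
    (hg (commutator_mem_commWith g y⁻¹)) g
  convert inv_mem h2 using 1
  rw [commutatorElement_def]
  group

theorem isNilpotent_of_exists_central [Finite G] {z : G} {p : ℕ} [hp : Fact p.Prime]
    (hz : z ∈ Subgroup.center G) (hzp : orderOf z = p)
    (hct : ∀ χ ∈ irrOver (Subgroup.zpowers z), HasCentralType χ) : Group.IsNilpotent G := by
  have hnormal : (Subgroup.zpowers z).Normal :=
    ⟨fun x hx g => by
      have hxc := (Subgroup.zpowers_le.2 hz) hx
      rwa [Subgroup.mem_center_iff.1 hxc g, mul_inv_cancel_right]⟩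
  obtain ⟨n, hn⟩ := exists_upperCentralSeries_closed G
  set Z := Subgroup.upperCentralSeries G n with hZdef
  have hcop : ∀ g : G, ¬ p ∣ orderOf g → g ∈ Z := by
    intro g hg
    have hnle : ¬ Subgroup.zpowers z ≤ commWith g := by
      intro hle
      have hc := isConj_mul_of_le_commWith _ hct hle (Subgroup.mem_zpowers z)
      -- Raising g ~ gz to the power o(g) gives z ^ o(g) = 1, so p ∣ o(g).
      have h1 := hc.pow (orderOf g)
      rw [Commute.mul_pow (Subgroup.mem_center_iff.1 hz g), pow_orderOf_eq_one, one_mul,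
        isConj_one_right, ← orderOf_dvd_iff_pow_eq_one, hzp] at h1
      exact hg h1
    refine hn g (le_of_forall_isFlat _ _ (fun x hx => ?_) fun x _ => hn x)
    exact isFlat_of_not_le_commWith _ hct fun h => hnle (h.trans (commWith_le_of_normal hx))
  have hpgroup : IsPGroup p (G ⧸ Z) := by
    intro q
    obtain ⟨g, rfl⟩ := QuotientGroup.mk_surjective q
    -- With o(g) = pᵏm and p ∤ m, the power g ^ pᵏ has order m and so lies in Z.
    obtain ⟨k, m, hm, hk⟩ :=
      Nat.exists_eq_pow_mul_and_not_dvd (orderOf_pos g).ne' p hp.out.ne_one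
    refine ⟨k, ?_⟩
    rw [← QuotientGroup.mk_pow, QuotientGroup.eq_one_iff]
    refine hcop _ ?_
    rwa [orderOf_pow_of_dvd (pow_pos hp.out.pos k).ne' (hk ▸ dvd_mul_right _ _), hk,
      Nat.mul_div_cancel_left _ (pow_pos hp.out.pos k)]
  refine ⟨n, ?_⟩
  by_contra hne
  have : Nontrivial (G ⧸ Z) := by
    rw [QuotientGroup.nontrivial_iff]
    exact hne
  have hcenter := hpgroup.center_nontrivial
  obtain ⟨⟨q, hq⟩, hq1⟩ := exists_ne (1 : Subgroup.center (G ⧸ Z))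
  obtain ⟨g, rfl⟩ := QuotientGroup.mk_surjective q
  refine hq1 (Subtype.ext ((QuotientGroup.eq_one_iff g).2 (hn g ?_)))
  refine (Subgroup.closure_le _).2 ?_
  rintro _ ⟨x, rfl⟩
  refine (QuotientGroup.eq_one_iff (N := Z) _).1 ?_
  have h1 := Subgroup.mem_center_iff.1 hq (x : G ⧸ Z)
  rw [QuotientGroup.mk_mul, QuotientGroup.mk_mul, QuotientGroup.mk_mul, QuotientGroup.mk_inv,
    QuotientGroup.mk_inv, mul_assoc, ← h1]
  group

end FinChar

theorem theoremA {G : Type*} [Group G] [Finite G] (N : Subgroup G) (hN : N.Normal)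
    (hN1 : N ≠ ⊥) (hct : ∀ χ ∈ FinChar.irrOver N, FinChar.HasCentralType χ) :
    Group.IsNilpotent G ∧ ∀ g ∈ N, FinChar.IsFlat g := by
  have hflat : ∀ g ∈ N, FinChar.IsFlat g := fun g hg => FinChar.isFlat_of_mem N hct hg
  obtain ⟨z, hzN, hz, hp⟩ := FinChar.exists_central_prime_order N hN1 hflat
  have : Fact (orderOf z).Prime := ⟨hp⟩
  refine ⟨FinChar.isNilpotent_of_exists_central hz rfl fun χ hχ => hct χ ?_, hflat⟩
  exact FinChar.irrOver_mono (by rwa [Subgroup.zpowers_le]) hχ
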